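/- Let $(K,v)$ be a field with a (Krull) valuation, fix an algebraic closure $\overline K$ of $K$ and an extension $\overline v$ of $v$ to $\overline K$. Let $K^{\rm sep}$ be the separable closure of $K$ in $\overline K$, let $K^h$ be the fixed field of $\{\sigma\in{\rm Gal}(K^{\rm sep}|K)\mid \overline v\circ\sigma=\overline v \text{ on } K^{\rm sep}\}$, and let $v^h=\overline v|_{K^h}$, so that $(K^h,v^h)$ is the henselization of $(K,v)$ determined by $\overline v$. For an extension $(L|K,w|v)$ of valued fields write $wL$, $vK$ for the value groups and $Lw$, $Kv$ for the residue fields; the extension is immediate if $wL=vK$ and $Lw=Kv$. A finite extension $(L|K,w|v)$ is a defect extension if its defect $$d(w/v)=\frac{[L^h:K^h]}{(wL:vK)\,[Lw:Kv]}$$ is greater than $1$, where the henselizations $K^h\subseteq L^h$ are formed, as above, inside an algebraic closure $\overline L$ of $L$ with respect to an extension of $w$ to $\overline L$ (the defect does not depend on the choices). The valued field $(K,v)$ is immediate-defectless if it has no finite extension $(L|K,w|v)$ that is both immediate and a defect extension. A valued field is algebraically maximal if it has no proper algebraic immediate valued field extension. Then $(K,v)$ is immediate-defectless if and only if $(K^h,v^h)$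 is algebraically maximal. -/

import Mathlib

/-!
Valuations are Mathlib's `Valuation K Γ₀` (written multiplicatively, with values in a linearly
ordered commutative group with zero). That `(L, w)` is a valued field extension of `(K, v)` is
Mathlib's `v.HasExtension w`: the restriction of `w` to `K` is `v`, up to the usual identification
of equivalent valuations.
-/

universe u

open IsLocalRing

noncomputable section

namespace ValuedFieldExt

section Henselization

variable (K : Type*) {Ω Γ : Type*} [Field K] [Field Ω] [Algebra K Ω]
  [LinearOrderedCommGroupWithZero Γ]

/-- The decomposition group `G^d = {σ ∈ Gal(K^sep | K) | v̄ ∘ σ = v̄}`, where `K^sep` is the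
separable closure of `K` in `Ω` and `v̄` is a valuation on `Ω`. -/
def decompositionGroup (vbar : Valuation Ω Γ) :
    Subgroup (separableClosure K Ω ≃ₐ[K] separableClosure K Ω) where
  carrier := {σ | ∀ x : separableClosure K Ω, vbar (σ x : Ω) = vbar (x : Ω)}
  one_mem' := fun _ => rfl
  mul_mem' := fun {σ τ} hσ hτ x => (hσ (τ x)).trans (hτ x)
  inv_mem' := fun {σ} hσ x => by
    have h := hσ (σ⁻¹ x)
    rw [← AlgEquiv.mul_apply, mul_inv_cancel, AlgEquiv.one_apply] at h
    exact h.symm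

/-- The henselization `K^h` of `K` with respect to `v̄`: the fixed field in `K^sep` of the
decomposition group, as a subfield of `Ω`. (It is used for `Ω` an algebraic closure of `K`.) -/
def henselization (vbar : Valuation Ω Γ) : IntermediateField K Ω :=
  IntermediateField.lift (IntermediateField.fixedField (decompositionGroup K vbar))

/-- The valuation `v^h`, the restriction of `v̄` to `K^h`. -/
def henselizationValuation (vbar : Valuation Ω Γ) : Valuation (henselization K vbar) Γ :=
  vbar.comap (algebraMap (henselization K vbar) Ω)

/-- Inside a common overfield `Ω`, `K^h ⊆ L^h`; so `relfinrank` below is the degree `[L^h : K^h]`. -/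
theorem henselization_le (L : Type*) [Field L] [Algebra K L] [Algebra L Ω] [IsScalarTower K L Ω]
    (vbar : Valuation Ω Γ) :
    henselization K vbar ≤ (henselization L vbar).restrictScalars K := by
  rintro _ ⟨x, hx, rfl⟩
  have hle : separableClosure K Ω ≤ (separableClosure L Ω).restrictScalars K :=
    separableClosure.le_restrictScalars K L Ω
  refine ⟨⟨(x : Ω), hle x.2⟩, fun τ => ?_, rfl⟩
  obtain ⟨σ, hσ⟩ := τ
  let f : separableClosure K Ω →ₐ[K] Ω :=
    ((separableClosure L Ω).val.restrictScalars K).comp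
      ((σ.toAlgHom.restrictScalars K).comp (IntermediateField.inclusion hle))
  let g : separableClosure K Ω →ₐ[K] separableClosure K Ω :=
    AlgHom.codRestrict f (separableClosure K Ω).toSubalgebra fun y =>
      mem_separableClosure_iff.2 (((mem_separableClosure_iff.1 y.2).of_algHom
        (separableClosure K Ω).val).map f f.injective)
  let ρ := AlgEquiv.ofBijective g (Algebra.IsAlgebraic.algHom_bijective g)
  have hρ : ρ ∈ decompositionGroup K vbar := fun y => hσ ⟨(y : Ω), hle y.2⟩
  have h : ρ x = x := hx ⟨ρ, hρ⟩
  exact Subtype.ext (congrArg (fun z : separableClosure K Ω => (z : Ω)) h)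

end Henselization

section Extension

variable {K L Γ₀ Γ₁ : Type*} [Field K] [Field L] [Algebra K L]
  [LinearOrderedCommGroupWithZero Γ₀] [LinearOrderedCommGroupWithZero Γ₁]

/-- The value group `wL` of a valuation `w` on `L`. -/
def valueGroup (w : Valuation L Γ₁) : Subgroup Γ₁ˣ :=
  MonoidWithZeroHom.valueGroup (MonoidWithZeroHom.ofClass w)

/-- The value group `vK` of the restriction of `w` to `K`, as a subgroup of the group in which `w`
takes its values. -/
def baseValueGroup (K : Type*) [Field K] [Algebra K L] (w : Valuation L Γ₁) : Subgroup Γ₁ˣ :=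
  valueGroup (w.comap (algebraMap K L))

/-- The ramification index `e(w/v) = (wL : vK)`. -/
def ramificationIndex (K : Type*) [Field K] [Algebra K L] (w : Valuation L Γ₁) : ℕ :=
  (baseValueGroup K w).relIndex (valueGroup w)

/-- The inertia degree `f(w/v) = [Lw : Kv]`. -/
def inertiaDegree (v : Valuation K Γ₀) (w : Valuation L Γ₁) [v.HasExtension w] : ℕ :=
  Module.finrank (ResidueField v.valuationSubring) (ResidueField w.valuationSubring)

/-- The extension `(L | K, w | v)` is immediate: `wL = vK` and `Lw = Kv`. -/
def IsImmediate (v : Valuation K Γ₀) (w : Valuation L Γ₁) [v.HasExtension w] : Prop :=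
  valueGroup w = baseValueGroup K w ∧
    Function.Bijective
      (algebraMap (ResidueField v.valuationSubring) (ResidueField w.valuationSubring))

/-- The defect `d(w/v) = [L^h : K^h] / (e(w/v) f(w/v))` of a finite extension `(L | K, w | v)`,
where the henselizations are formed inside a common algebraic closure `Ω` of `L` and `K`, with
respect to an extension `w̄` of `w` to `Ω`. -/
def defect {Ω Γ₂ : Type*} [Field Ω] [Algebra L Ω] [Algebra K Ω] [IsScalarTower K L Ω]
    [LinearOrderedCommGroupWithZero Γ₂]
    (v : Valuation K Γ₀) (w : Valuation L Γ₁) [v.HasExtension w] (wbar : Valuation Ω Γ₂) : ℚ :=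
  (IntermediateField.relfinrank (henselization K wbar)
      ((henselization L wbar).restrictScalars K) : ℚ) /
    ((ramificationIndex K w : ℚ) * (inertiaDegree v w : ℚ))

end Extension

section Fields

variable {K L : Type u} {Γ₀ Γ₁ : Type*} [Field K] [Field L] [Algebra K L]
  [LinearOrderedCommGroupWithZero Γ₀] [LinearOrderedCommGroupWithZero Γ₁]

/-- `(L | K, w | v)` is a defect extension: it is finite and `d(w/v) > 1`. The defect does not
depend on the extension `w̄` of `w` to the algebraic closure of `L`. -/
def IsDefectExtension (v : Valuation K Γ₀) (w : Valuation L Γ₁) [v.HasExtension w] : Prop :=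
  FiniteDimensional K L ∧
    ∃ (Γ₂ : Type u) (_ : LinearOrderedCommGroupWithZero Γ₂)
      (wbar : Valuation (AlgebraicClosure L) Γ₂),
      w.HasExtension wbar ∧ 1 < defect v w wbar

/-- `(K, v)` is immediate-defectless: it admits no immediate defect extensions. -/
def IsImmediateDefectless (v : Valuation K Γ₀) : Prop :=
  ∀ (L : Type u) [Field L] [Algebra K L] (Γ₁ : Type u) [LinearOrderedCommGroupWithZero Γ₁]
    (w : Valuation L Γ₁) [v.HasExtension w], ¬ (IsImmediate v w ∧ IsDefectExtension v w)

/-- `(K, v)` is algebraically maximal: it admits no proper algebraic immediate extensions. -/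
def IsAlgebraicallyMaximal (v : Valuation K Γ₀) : Prop :=
  ∀ (L : Type u) [Field L] [Algebra K L] (Γ₁ : Type u) [LinearOrderedCommGroupWithZero Γ₁]
    (w : Valuation L Γ₁) [v.HasExtension w], Algebra.IsAlgebraic K L → IsImmediate v w →
    Function.Bijective (algebraMap K L)

end Fields

end ValuedFieldExt

end

/-! An extension is immediate exactly when each nonzero `x` above admits `c` below with `w (x - c) <
w x` (`isImmediate_iff`). In this form immediacy passes up and down towers, and the henselization is
immediate (`exists_map_sub_lt_of_mem_henselization`). For an immediate finite `L|K` the defect is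
just `[L^h : K^h]`.

If `K^h` is algebraically maximal and `L|K` is finite and immediate, then `L^h` is immediate over
`L`, hence over `K^h`, so `L^h = K^h` and the defect is `1`. Conversely, if `F|K^h` is algebraic and
immediate and `a ∈ F` is not in `K^h`, then `L = K(a)` is immediate over `K`, and `a ∈ L^h` forces
`[L^h : K^h] > 1`.

The valuation theory behind this rests on two facts. Extensions of `v` to a Galois extension are
conjugate (`exists_isEquiv_comap_of_isGalois`), because the Galois group is transitive on primes of
the integral closure over a given prime; this makes henselizations in different algebraic closures
comparable. And an element fixed by the decomposition group of a finite Galois extension is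
approximable from `K` (`exists_map_sub_lt_of_fixed`): it is modified until no other conjugate has
its value, and then a quotient of consecutive elementary symmetric functions of the conjugates
approximates it. -/

open IsLocalRing

noncomputable section

namespace ValuedFieldExt

/-! ### Valuations and their centers in the integral closure -/

section IntegralClosure

open Polynomial

/-- If `x` with `w x ≤ 1` is a root of a polynomial over the integral closure `B` of `O` one of
whose coefficients is a `w`-unit, then `x` is a fraction of elements of `B` with denominator a
`w`-unit. -/
theorem exists_unit_mul_mem_integralClosure {O N Γ : Type*} [CommRing O] [Field N] [Algebra O N]
    [LinearOrderedCommGroupWithZero Γ] (w : Valuation N Γ)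
    (hw : ∀ a ∈ integralClosure O N, w a ≤ 1) {x : N} (hx : w x ≤ 1) (f : (integralClosure O N)[X])
    (hf : aeval x f = 0) (hu : ∃ i, w (f.coeff i : N) = 1) :
    ∃ s ∈ integralClosure O N, w s = 1 ∧ s * x ∈ integralClosure O N := by
  induction hn : f.natDegree using Nat.strong_induction_on generalizing f with
  | _ n ih =>
  have hintegral : IsIntegral O ((f.leadingCoeff : N) * x) := by
    have h := isIntegral_leadingCoeff_smul f x hf
    exact isIntegral_trans _ h
  by_cases hl : w (f.leadingCoeff : N) = 1
  · exact ⟨_, f.leadingCoeff.2, hl, hintegral⟩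
  obtain ⟨i, hi⟩ := hu
  have hil : i ≠ f.natDegree := by rintro rfl; exact hl hi
  have hfi : f.coeff i ≠ 0 := by rintro h; simp [h] at hi
  have hin : i < f.natDegree := lt_of_le_of_ne (le_natDegree_of_ne_zero hfi) hil
  have hl1 : w (f.leadingCoeff : N) < 1 := lt_of_le_of_ne (hw _ f.leadingCoeff.2) hl
  obtain ⟨m, hm⟩ : ∃ m, f.natDegree = m + 1 := ⟨f.natDegree - 1, by omega⟩
  let b : integralClosure O N := ⟨_, hintegral⟩
  -- The leading term at `x` equals `b * x ^ m` with `b` integral, so it folds into the next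
  -- coefficient. Since `w b < 1`, the unit coefficient stays a unit.
  let g := f.eraseLead + C b * X ^ m
  have hgd : g.natDegree ≤ m := by
    refine natDegree_add_le_of_degree_le ?_ (natDegree_C_mul_X_pow_le _ _)
    have := eraseLead_natDegree_le f
    omega
  refine ih g.natDegree (by omega) g ?_ ?_ rfl
  · have h : f = f.eraseLead + C f.leadingCoeff * X ^ (m + 1) := by
      rw [← hm]; exact (eraseLead_add_C_mul_X_pow f).symm
    rw [h] at hf
    rw [← hf]
    simp only [g, b, map_add, map_mul, aeval_C, map_pow, aeval_X, pow_succ]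
    congr 1
    change ((f.leadingCoeff : N) * x) * x ^ m = (f.leadingCoeff : N) * (x ^ m * x)
    ring
  · refine ⟨i, ?_⟩
    have hb : w (b : N) < 1 := by
      change w ((f.leadingCoeff : N) * x) < 1
      rw [map_mul]
      exact mul_lt_one_of_lt_of_le hl1 hx
    simp only [g, coeff_add, coeff_C_mul, coeff_X_pow, eraseLead_coeff_of_ne i hil]
    split_ifs with him
    · rw [mul_one, AddMemClass.coe_add, Valuation.map_add_eq_of_lt_left _ (by rwa [hi]), hi]
    · simpa using hi

variable {K N Γ₀ Γ : Type*} [Field K] [Field N] [Algebra K N]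
  [LinearOrderedCommGroupWithZero Γ₀] [LinearOrderedCommGroupWithZero Γ]
  (v : Valuation K Γ₀) (w : Valuation N Γ) [v.HasExtension w]

theorem map_le_one_of_isIntegral {x : N} (hx : IsIntegral v.integer x) : w x ≤ 1 := by
  have : IsIntegral w.integer x := hx.tower_top
  exact (Valuation.integer.integers w).mem_of_integral this

/-- Dividing an equation of `x` by a coefficient of largest value makes it integral with one
coefficient equal to `1`, as the previous descent requires. So the valuation ring of `w` is the
localization of the integral closure at its center. -/
theorem exists_unit_mul_isIntegral {x : N} (hxa : IsAlgebraic K x) (hx : w x ≤ 1) :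
    ∃ s : N, IsIntegral v.integer s ∧ w s = 1 ∧ IsIntegral v.integer (s * x) := by
  obtain ⟨p, hp, hpx⟩ := hxa
  obtain ⟨i, hi, hmax⟩ := p.support.exists_max_image (fun i => v (p.coeff i))
    (Polynomial.support_nonempty.2 hp)
  have hi0 : p.coeff i ≠ 0 := by simpa using hi
  have hle : ∀ j, v ((C (p.coeff i)⁻¹ * p).coeff j) ≤ 1 := by
    intro j
    rw [coeff_C_mul, map_mul, map_inv₀]
    by_cases hj : p.coeff j = 0
    · simp [hj]
    · have := hmax j (by simpa using hj)
      rwa [inv_mul_le_one₀ (by simpa [zero_lt_iff] using hi0)]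
  let q : v.integer[X] := (C (p.coeff i)⁻¹ * p).toSubring v.integer fun a ha => by
    obtain ⟨j, -, rfl⟩ := Polynomial.mem_coeffs_iff.1 ha
    exact hle j
  have hq : q.map (algebraMap v.integer K) = C (p.coeff i)⁻¹ * p := Polynomial.map_toSubring _ _ _
  have hqi : q.coeff i = 1 := by
    apply Subtype.ext
    have h := congrArg (fun r => r.coeff i) hq
    simpa [hi0] using h
  refine exists_unit_mul_mem_integralClosure w (fun a ha => map_le_one_of_isIntegral v w ha) hx
    (q.map (algebraMap _ _)) ?_ ⟨i, ?_⟩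
  · rw [aeval_map_algebraMap, ← aeval_map_algebraMap K, hq, map_mul, hpx, mul_zero]
  · rw [coeff_map, hqi]
    simp

/-- The ideal of elements of value less than one in the integral closure of `v.integer`. -/
def integralCenter : Ideal (integralClosure v.integer N) where
  carrier := {b | w (b : N) < 1}
  add_mem' := fun ha hb => w.map_add_lt ha hb
  zero_mem' := by simp
  smul_mem' := fun c b hb => by
    change w ((c : N) * b) < 1
    rw [map_mul]
    exact mul_lt_one_of_nonneg_of_lt_one_right (map_le_one_of_isIntegral v w c.2) zero_le hb

theorem mem_integralCenter {b : integralClosure v.integer N} :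
    b ∈ integralCenter v w ↔ w (b : N) < 1 := Iff.rfl

instance : (integralCenter v w).IsPrime where
  ne_top' h := by
    have : (1 : integralClosure v.integer N) ∈ integralCenter v w := h ▸ Submodule.mem_top
    simp [mem_integralCenter] at this
  mem_or_mem' := fun {a b} hab => by
    have ha := map_le_one_of_isIntegral v w a.2
    have hb := map_le_one_of_isIntegral v w b.2
    simp only [mem_integralCenter] at hab ⊢
    by_contra! h
    have ha' := le_antisymm ha h.1
    have hb' := le_antisymm hb h.2
    simp [ha', hb'] at hab

theorem mem_under_integralCenter {a : v.integer} :
    a ∈ (integralCenter v w).under v.integer ↔ v (a : K) < 1 := by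
  rw [Ideal.under_def, Ideal.mem_comap, mem_integralCenter]
  exact Valuation.HasExtension.val_map_lt_one_iff v w (a : K)

/-- Integrality reduces this to the contraction, which is the maximal ideal of the valuation ring of
`v`. -/
instance : (integralCenter v w).IsMaximal := by
  have : ((integralCenter v w).under v.integer).IsMaximal := by
    rw [Ideal.isMaximal_iff]
    refine ⟨fun h => by
      have := (mem_under_integralCenter v w).1 h
      simp at this, fun J x hJ hx hxJ => ?_⟩
    have hx1 : v (x : K) = 1 := le_antisymm x.2 (not_lt.1 fun h =>
      hx ((mem_under_integralCenter v w).2 h))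
    have hx0 : (x : K) ≠ 0 := by rintro h; simp [h] at hx1
    have := J.mul_mem_left ⟨(x : K)⁻¹, by simp [Valuation.mem_integer_iff, hx1]⟩ hxJ
    convert this
    exact Subtype.ext (inv_mul_cancel₀ hx0).symm
  exact Ideal.isMaximal_of_isIntegral_of_isMaximal_comap _ this

/-- Write `x` as a fraction of integral elements whose denominator is a `w`-unit; matching centers
make its image a `w'`-unit. -/
theorem map_le_one_of_integralCenter {Γ' : Type*} [LinearOrderedCommGroupWithZero Γ']
    [Algebra.IsAlgebraic K N] (w' : Valuation N Γ') [v.HasExtension w'] (σ : N ≃ₐ[K] N)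
    (h : ∀ x : N, IsIntegral v.integer x → (w x < 1 ↔ w' (σ x) < 1)) {x : N} (hx : w x ≤ 1) :
    w' (σ x) ≤ 1 := by
  have hintegral : ∀ y, IsIntegral v.integer y → IsIntegral v.integer (σ y) := fun y hy =>
    hy.map (σ.toAlgHom.restrictScalars v.integer)
  obtain ⟨s, hs, hs1, hsx⟩ :=
    exists_unit_mul_isIntegral v w (Algebra.IsAlgebraic.isAlgebraic x) hx
  have h1 : w' (σ s) = 1 := le_antisymm (map_le_one_of_isIntegral v w' (hintegral _ hs))
    (not_lt.1 fun hlt => hs1.not_lt ((h s hs).2 hlt))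
  have h2 := map_le_one_of_isIntegral v w' (hintegral _ hsx)
  rwa [map_mul, map_mul, h1, one_mul] at h2

/-- An automorphism over `K` that matches the centers of two extensions of `v` in the integral
closure of the valuation ring of `v` matches their valuation rings. -/
theorem isEquiv_comap_of_integralCenter {Γ' : Type*} [LinearOrderedCommGroupWithZero Γ']
    [Algebra.IsAlgebraic K N] (w' : Valuation N Γ') [v.HasExtension w'] (σ : N ≃ₐ[K] N)
    (h : ∀ x : N, IsIntegral v.integer x → (w x < 1 ↔ w' (σ x) < 1)) :
    w.IsEquiv (w'.comap (σ : N →+* N)) := by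
  refine Valuation.isEquiv_of_val_le_one fun x =>
    ⟨map_le_one_of_integralCenter v w w' σ h, fun hx => ?_⟩
  have := map_le_one_of_integralCenter v w' w σ.symm (fun x hx => ?_) (x := σ x) hx
  · simpa using this
  · have := h (σ.symm x) (hx.map (σ.symm.toAlgHom.restrictScalars v.integer))
    simpa using this.symm

end IntegralClosure

/-! ### Conjugacy of extensions in Galois extensions -/

section Conjugacy

variable {K N Γ₀ Γ Γ' : Type*} [Field K] [Field N] [Algebra K N]
  [LinearOrderedCommGroupWithZero Γ₀] [LinearOrderedCommGroupWithZero Γ]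
  [LinearOrderedCommGroupWithZero Γ']

/-- An automorphism of an algebraic extension that respects a valuation up to equivalence
respects it exactly. -/
theorem map_eq_of_isEquiv_comap [Algebra.IsAlgebraic K N] (w : Valuation N Γ) (σ : N ≃ₐ[K] N)
    (h : w.IsEquiv (w.comap (σ : N →+* N))) (x : N) : w (σ x) = w x := by
  -- The orbit of `x` consists of roots of its minimal polynomial. If `σ` changed the value of `x`,
  -- the values along the orbit would be strictly monotone, hence infinitely many.
  have hfin : {y : N | ∃ n : ℕ, (σ ^ n) x = y}.Finite := by
    refine ((minpoly K x).rootSet_finite N).subset ?_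
    rintro _ ⟨n, rfl⟩
    rw [Polynomial.mem_rootSet]
    refine ⟨minpoly.ne_zero (Algebra.IsIntegral.isIntegral x), ?_⟩
    have : Polynomial.aeval ((σ ^ n) x) (minpoly K x) = 0 := by
      rw [Polynomial.aeval_algEquiv, AlgHom.comp_apply, minpoly.aeval, map_zero]
    exact this
  have hno : ∀ (f : ℕ → Γ), (∀ n, f n = w ((σ ^ n) x)) → ¬ Function.Injective f := by
    intro f hf hinj
    have : Function.Injective fun n : ℕ => (σ ^ n) x := fun a b hab => hinj (by
      rw [hf, hf]; exact congrArg w hab)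
    exact Set.infinite_range_of_injective this (hfin.subset (by rintro _ ⟨n, rfl⟩; exact ⟨n, rfl⟩))
  have hlt : ∀ {a b : N}, w a < w b ↔ w (σ a) < w (σ b) := Valuation.isEquiv_iff_val_lt_val.1 h
  have hs : ∀ n, (σ ^ (n + 1)) x = σ ((σ ^ n) x) := fun n => by rw [pow_succ']; rfl
  rcases lt_trichotomy (w (σ x)) (w x) with h1 | h1 | h1
  · refine absurd (strictAnti_nat_of_succ_lt (f := fun n => w ((σ ^ n) x)) fun n => ?_).injective
      (hno _ fun _ => rfl)
    induction n with
    | zero => simpa using h1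
    | succ n ih => rw [hs (n + 1), hs n]; rw [hs n] at ih; exact hlt.1 ih
  · exact h1
  · refine absurd (strictMono_nat_of_lt_succ (f := fun n => w ((σ ^ n) x)) fun n => ?_).injective
      (hno _ fun _ => rfl)
    induction n with
    | zero => simpa using h1
    | succ n ih => rw [hs (n + 1), hs n]; rw [hs n] at ih; exact hlt.1 ih

open scoped Pointwise in
/-- The extensions of a valuation to a Galois extension are conjugate. -/
theorem exists_isEquiv_comap_of_isGalois [IsGalois K N] (v : Valuation K Γ₀) (w : Valuation N Γ)
    (w' : Valuation N Γ') [v.HasExtension w] [v.HasExtension w'] :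
    ∃ σ : N ≃ₐ[K] N, w.IsEquiv (w'.comap (σ : N →+* N)) := by
  let B := integralClosure v.integer N
  -- The profinite Galois group acts continuously on the discrete ring `B`, with invariants the
  -- valuation ring of `v`; hence it is transitive on primes with the same contraction.
  let _ : TopologicalSpace B := ⊥
  have : DiscreteTopology B := ⟨rfl⟩
  have : ContinuousSMul (N ≃ₐ[K] N) B := by
    rw [continuousSMul_iff_stabilizer_isOpen]
    intro x
    convert stabilizer_isOpen_of_isIntegral (K := K) (x : N) using 1
    ext g
    exact Subtype.ext_iff
  have : Algebra.IsInvariant v.integer B (N ≃ₐ[K] N) := by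
    refine ⟨fun b hb => ?_⟩
    obtain ⟨a, ha⟩ := (InfiniteGalois.mem_range_algebraMap_iff_fixed (k := K) (b : N)).2
      fun g => congrArg Subtype.val (hb g)
    have hai : IsIntegral v.integer a := by
      have := b.2
      rw [← ha] at this
      exact (isIntegral_algebraMap_iff (algebraMap K N).injective).1 this
    exact ⟨⟨a, (Valuation.integer.integers v).mem_of_integral hai⟩, Subtype.ext ha⟩
  have : SMulCommClass (N ≃ₐ[K] N) v.integer B :=
    ⟨fun g a b => Subtype.ext (map_smul g (a : K) (b : N))⟩
  obtain ⟨g, hg⟩ := Algebra.IsInvariant.exists_smul_of_under_eq_of_profinite (A := v.integer)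
    (G := N ≃ₐ[K] N) (integralCenter v w) (integralCenter v w') (by
      ext a
      rw [mem_under_integralCenter, mem_under_integralCenter])
  refine ⟨g, isEquiv_comap_of_integralCenter v w w' g fun x hx => ?_⟩
  have h1 : (g • (⟨x, hx⟩ : B)) ∈ integralCenter v w' ↔ (⟨x, hx⟩ : B) ∈ integralCenter v w := by
    rw [hg, Ideal.smul_mem_pointwise_smul_iff]
  exact h1.symm

end Conjugacy

/-! ### Algebraic closures, decomposition groups and henselizations -/

section AlgebraicClosure

variable {K Ω Γ₀ Γ Γ' : Type*} [Field K] [Field Ω] [Algebra K Ω]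
  [LinearOrderedCommGroupWithZero Γ₀] [LinearOrderedCommGroupWithZero Γ]
  [LinearOrderedCommGroupWithZero Γ']

/-- Valuations on an algebraic extension are determined by their restrictions to the relative
separable closure. -/
theorem isEquiv_of_separableClosure [Algebra.IsAlgebraic K Ω] (w : Valuation Ω Γ)
    (w' : Valuation Ω Γ') (h : ∀ x ∈ separableClosure K Ω, w x ≤ 1 ↔ w' x ≤ 1) :
    w.IsEquiv w' := by
  refine Valuation.isEquiv_of_val_le_one fun x => ?_
  let q := ringExpChar (separableClosure K Ω)
  have : ExpChar (separableClosure K Ω) q := ringExpChar.expChar _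
  -- Some `x ^ q ^ n` is separable, and `w x ≤ 1` can be tested on powers.
  obtain ⟨n, y, hy⟩ := IsPurelyInseparable.pow_mem (separableClosure K Ω) q x
  have hn : q ^ n ≠ 0 := pow_ne_zero _ (expChar_pos (separableClosure K Ω) q).ne'
  have := h (x ^ q ^ n) (hy ▸ y.2)
  rwa [map_pow, map_pow, pow_le_one_iff hn, pow_le_one_iff hn] at this

theorem map_eq_of_separableClosure [Algebra.IsAlgebraic K Ω] (w : Valuation Ω Γ) (σ : Ω ≃ₐ[K] Ω)
    (h : ∀ x ∈ separableClosure K Ω, w (σ x) = w x) (x : Ω) : w (σ x) = w x :=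
  map_eq_of_isEquiv_comap w σ
    (isEquiv_of_separableClosure w _ fun y hy => by
      change _ ↔ w (σ y) ≤ 1
      rw [h y hy]) x

/-- Two algebraic closures of a valued field, with extensions of its valuation, are isomorphic as
valued fields. -/
theorem exists_algEquiv_isEquiv {Ω' : Type*} [Field Ω'] [Algebra K Ω'] [IsAlgClosure K Ω]
    [IsAlgClosure K Ω'] (v : Valuation K Γ₀) (w : Valuation Ω Γ) (w' : Valuation Ω' Γ')
    [hw : v.HasExtension w] [hw' : v.HasExtension w'] :
    ∃ φ : Ω ≃ₐ[K] Ω', w.IsEquiv (w'.comap (φ : Ω →+* Ω')) := by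
  have : Normal K Ω := IsAlgClosure.normal K Ω
  have : Algebra.IsAlgebraic K Ω := IsAlgClosure.isAlgebraic
  let e : Ω ≃ₐ[K] Ω' := IsAlgClosure.equiv K Ω Ω'
  let S := separableClosure K Ω
  let w₁ : Valuation S Γ := w.comap (algebraMap S Ω)
  let w₂ : Valuation S Γ' := w'.comap ((e : Ω →+* Ω').comp (algebraMap S Ω))
  have : v.HasExtension w₁ := ⟨hw.val_isEquiv_comap⟩
  have : v.HasExtension w₂ := ⟨by
    convert hw'.val_isEquiv_comap using 1
    ext x
    change w' (e (algebraMap K Ω x)) = _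
    rw [e.commutes]
    rfl⟩
  obtain ⟨σ, hσ⟩ := exists_isEquiv_comap_of_isGalois v w₁ w₂
  -- An arbitrary isomorphism `e` is corrected by an automorphism that aligns the valuations on the
  -- separable closure.
  refine ⟨(σ.liftNormal Ω).trans e, isEquiv_of_separableClosure (K := K) w _ fun x hx => ?_⟩
  have h1 := Valuation.isEquiv_iff_val_le_one.1 hσ (x := ⟨x, hx⟩)
  refine h1.trans ?_
  change w' (e (algebraMap S Ω (σ ⟨x, hx⟩))) ≤ 1 ↔ w' (e (σ.liftNormal Ω x)) ≤ 1
  rw [← AlgEquiv.liftNormal_commutes]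
  rfl

/-- Every valuation on a field extends to every overfield. -/
theorem exists_valuation_hasExtension {F : Type*} {E : Type u} [Field F] [Field E] [Algebra F E]
    (w : Valuation F Γ) :
    ∃ (Γ₂ : Type u) (_ : LinearOrderedCommGroupWithZero Γ₂) (w' : Valuation E Γ₂),
      w.HasExtension w' := by
  -- `A` dominates the image of the valuation ring of `w`. Locality gives the converse inclusion: if
  -- `w x > 1`, then `x⁻¹` is a nonunit, so `x` cannot lie in `A`.
  obtain ⟨A, hA, hloc⟩ := IsLocalRing.exists_factor_valuationRing
    ((algebraMap F E).comp w.valuationSubring.subtype)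
  refine ⟨A.ValueGroup, inferInstance, A.valuation, ⟨Valuation.isEquiv_of_val_le_one fun x => ?_⟩⟩
  rw [Valuation.comap_apply, ValuationSubring.valuation_le_one_iff]
  refine ⟨fun hx => hA ⟨x, hx⟩, fun hx => ?_⟩
  by_contra! hlt
  have hx0 : x ≠ 0 := by rintro rfl; simp at hlt
  have hxi : w x⁻¹ < 1 := by
    rw [map_inv₀]
    exact inv_lt_one_of_one_lt₀ hlt
  let y : w.valuationSubring := ⟨x⁻¹, hxi.le⟩
  have hy : IsUnit y := by
    refine hloc.1 y (IsUnit.of_mul_eq_one (⟨algebraMap F E x, hx⟩ : A.toSubring) (Subtype.ext ?_))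
    change algebraMap F E x⁻¹ * algebraMap F E x = 1
    rw [← map_mul, inv_mul_cancel₀ hx0, map_one]
  obtain ⟨z, hz⟩ := hy.exists_right_inv
  have hz' : x⁻¹ * (z : F) = 1 := congrArg Subtype.val hz
  have : w (x⁻¹ * (z : F)) < 1 := by
    rw [map_mul]
    exact mul_lt_one_of_nonneg_of_lt_one_left zero_le hxi z.2
  rw [hz', map_one] at this
  exact lt_irrefl _ this

theorem mem_henselization_iff_exists (vbar : Valuation Ω Γ) {x : Ω} :
    x ∈ henselization K vbar ↔ ∃ hx : x ∈ separableClosure K Ω,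
      ∀ τ ∈ decompositionGroup K vbar, τ ⟨x, hx⟩ = ⟨x, hx⟩ := by
  constructor
  · rintro ⟨y, hy, rfl⟩
    exact ⟨y.2, fun τ hτ => hy ⟨τ, hτ⟩⟩
  · rintro ⟨hx, h⟩
    exact ⟨⟨x, hx⟩, fun τ => h τ.1 τ.2, rfl⟩

/-- Automorphisms of `K^sep` lift to `Ω`, and preservation of values lifts with them, so the
decomposition group may be replaced by automorphisms of `Ω`. -/
theorem mem_henselization_iff [Normal K Ω] (vbar : Valuation Ω Γ) {x : Ω} :
    x ∈ henselization K vbar ↔ x ∈ separableClosure K Ω ∧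
      ∀ σ : Ω ≃ₐ[K] Ω, (∀ y, vbar (σ y) = vbar y) → σ x = x := by
  rw [mem_henselization_iff_exists]
  constructor
  · rintro ⟨hx, h⟩
    refine ⟨hx, fun σ hσ => ?_⟩
    have hc := AlgEquiv.restrictNormal_commutes σ (separableClosure K Ω)
    have := h (σ.restrictNormal (separableClosure K Ω)) fun y => by
      rw [← hσ y]
      exact congrArg vbar (hc y)
    exact (hc ⟨x, hx⟩).symm.trans (congrArg (algebraMap _ Ω) this)
  · rintro ⟨hx, h⟩
    refine ⟨hx, fun τ hτ => Subtype.ext ?_⟩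
    have hc := AlgEquiv.liftNormal_commutes τ Ω
    refine (hc ⟨x, hx⟩).symm.trans (h (τ.liftNormal Ω) (map_eq_of_separableClosure vbar _ ?_))
    intro y hy
    exact (congrArg vbar (hc ⟨y, hy⟩)).trans (hτ ⟨y, hy⟩)

/-- Each condition on `σ` depends only on `σ x` for one `x`, hence is closed in the Krull topology.
Closedness lets the infinite Galois correspondence recover the group from `K^h`. -/
theorem isClosed_decompositionGroup [Normal K Ω] (vbar : Valuation Ω Γ) :
    IsClosed (decompositionGroup K vbar : Set Gal(separableClosure K Ω/K)) := by
  let _ : TopologicalSpace (separableClosure K Ω) := ⊥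
  have : DiscreteTopology (separableClosure K Ω) := ⟨rfl⟩
  have : ContinuousSMul Gal(separableClosure K Ω/K) (separableClosure K Ω) :=
    continuousSMul_iff_stabilizer_isOpen.2 stabilizer_isOpen_of_isIntegral
  have : (decompositionGroup K vbar : Set Gal(separableClosure K Ω/K)) =
      ⋂ x : separableClosure K Ω, (fun σ => σ • x) ⁻¹' {y | vbar (y : Ω) = vbar (x : Ω)} := by
    ext σ
    simp only [Set.mem_iInter]
    rfl
  rw [this]
  exact isClosed_iInter fun x =>
    (isClosed_discrete _).preimage (continuous_id.smul continuous_const)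

/-- An automorphism that fixes the henselization respects the valuation. -/
theorem map_eq_of_fixes_henselization [Normal K Ω] (vbar : Valuation Ω Γ) (σ : Ω ≃ₐ[K] Ω)
    (hσ : ∀ x ∈ henselization K vbar, σ x = x) (x : Ω) : vbar (σ x) = vbar x := by
  refine map_eq_of_separableClosure vbar σ (fun y hy => ?_) x
  have hc := AlgEquiv.restrictNormal_commutes σ (separableClosure K Ω)
  have hmem : σ.restrictNormal (separableClosure K Ω) ∈ decompositionGroup K vbar := by
    have := InfiniteGalois.fixingSubgroup_fixedField
      (⟨decompositionGroup K vbar, isClosed_decompositionGroup vbar⟩ :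
        ClosedSubgroup Gal(separableClosure K Ω/K))
    change _ ∈ ((⟨decompositionGroup K vbar, isClosed_decompositionGroup vbar⟩ :
        ClosedSubgroup Gal(separableClosure K Ω/K))).1
    rw [← this, IntermediateField.mem_fixingSubgroup_iff]
    intro z hz
    exact Subtype.ext ((hc z).trans (hσ z ⟨z, hz, rfl⟩))
  exact (congrArg vbar (hc ⟨y, hy⟩)).symm.trans (hmem ⟨y, hy⟩)

/-- The henselization is functorial under isomorphisms of valued fields. -/
theorem map_mem_henselization_iff {Ω' : Type*} [Field Ω'] [Algebra K Ω'] [Normal K Ω]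
    (w : Valuation Ω Γ) (w' : Valuation Ω' Γ') (φ : Ω ≃ₐ[K] Ω')
    (h : w.IsEquiv (w'.comap (φ : Ω →+* Ω'))) {x : Ω} :
    φ x ∈ henselization K w' ↔ x ∈ henselization K w := by
  have : Normal K Ω' := Normal.of_algEquiv φ
  have heq : ∀ a b : Ω, w a = w b ↔ w' (φ a) = w' (φ b) := fun a b => h.eq_iff
  rw [mem_henselization_iff, mem_henselization_iff, mem_separableClosure_iff,
    mem_separableClosure_iff]
  refine and_congr ?_ ⟨fun H σ hσ => ?_, fun H σ hσ => ?_⟩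
  · simp only [IsSeparable]
    rw [minpoly.algEquiv_eq]
  · have := H ((φ.symm.trans σ).trans φ) fun y => by
      have := (heq (σ (φ.symm y)) (φ.symm y)).1 (hσ _)
      simpa using this
    simpa using this
  · have := H ((φ.trans σ).trans φ.symm) fun y => by
      rw [heq]
      simpa using hσ (φ y)
    simpa [AlgEquiv.symm_apply_eq] using this

end AlgebraicClosure

/-! ### Approximating elements fixed by the decomposition group -/

section Approximation

variable {K N Γ : Type*} [Field K] [Field N] [Algebra K N] [LinearOrderedCommGroupWithZero Γ]

theorem map_eq_of_map_sub_lt (w : Valuation N Γ) {a b : N} (h : w (a - b) < w b) :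
    w a = w b := by
  rw [← w.map_add_eq_of_lt_left h, add_sub_cancel]

theorem prod_lt_prod_of_forall_lt {ι : Type*} (f : ι → Γ) {A B : Finset ι}
    (hcard : A.card = B.card) (hA : A.Nonempty) (h : ∀ a ∈ A, ∀ b ∈ B, f a < f b) :
    ∏ a ∈ A, f a < ∏ b ∈ B, f b := by
  have hB : B.Nonempty := by rwa [← Finset.card_pos, ← hcard, Finset.card_pos]
  obtain ⟨a, ha, hmax⟩ := A.exists_max_image f hA
  obtain ⟨b, hb, hmin⟩ := B.exists_min_image f hB
  calc ∏ a ∈ A, f a ≤ f a ^ A.card := Finset.prod_le_pow_card _ _ _ hmax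
    _ < f b ^ A.card := pow_lt_pow_left₀ (h a ha b hb) zero_le hA.card_pos.ne'
    _ ≤ ∏ b ∈ B, f b := by
      rw [hcard]
      exact Finset.pow_card_le_prod _ _ _ hmin

/-- If the elements of `U ⊆ S` have larger value than the other elements of `S`, then the
elementary symmetric function of degree `|U|` in `S` is dominated by the product over `U`. -/
theorem map_esymm_sub_prod_lt [DecidableEq N] (w : Valuation N Γ) {S U : Finset N}
    (h0 : (0 : N) ∉ S) (hU : U ⊆ S) (h : ∀ s ∈ S \ U, ∀ u ∈ U, w s < w u) :
    w ((∑ T ∈ S.powersetCard U.card, ∏ t ∈ T, t) - ∏ u ∈ U, u) < w (∏ u ∈ U, u) := by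
  have hmem : U ∈ S.powersetCard U.card := Finset.mem_powersetCard.2 ⟨hU, rfl⟩
  rw [← Finset.sum_erase_add _ _ hmem, add_sub_cancel_right]
  refine w.map_sum_lt ?_ fun T hT => ?_
  · rw [Valuation.ne_zero_iff, Finset.prod_ne_zero_iff]
    rintro u hu rfl
    exact h0 (hU hu)
  obtain ⟨hTU, hT⟩ := Finset.mem_erase.1 hT
  obtain ⟨hTS, hcard⟩ := Finset.mem_powersetCard.1 hT
  have hne : (T \ U).Nonempty := by
    rw [Finset.sdiff_nonempty]
    exact fun hle => hTU (Finset.eq_of_subset_of_card_le hle hcard.ge)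
  -- Cancel the common part `T ∩ U`; what remains compares equally many small and large factors.
  rw [map_prod, map_prod, ← Finset.prod_inter_mul_prod_sdiff T U,
    ← Finset.prod_inter_mul_prod_sdiff U T, Finset.inter_comm U T]
  refine mul_lt_mul_of_pos_left ?_ ?_
  · refine prod_lt_prod_of_forall_lt _ (Finset.card_sdiff_comm hcard) hne fun a ha b hb => ?_
    rw [Finset.mem_sdiff] at ha hb
    exact h a (Finset.mem_sdiff.2 ⟨hTS ha.1, ha.2⟩) b hb.1
  · rw [zero_lt_iff, Finset.prod_ne_zero_iff]
    intro u hu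
    rw [Valuation.ne_zero_iff]
    rintro rfl
    exact h0 (hTS (Finset.mem_inter.1 hu).1)

/-- An element `z` of a finite Galois extension of `K` with larger or smaller value than each of
its other conjugates can be approximated by elements of `K`. -/
theorem exists_map_sub_lt_of_isolated [FiniteDimensional K N] [IsGalois K N] (w : Valuation N Γ)
    {z : N} (hz : z ≠ 0) (h : ∀ σ : N ≃ₐ[K] N, w (σ z) = w z → σ z = z) :
    ∃ c : K, w (z - algebraMap K N c) < w z := by
  classical
  let S : Finset N := Finset.univ.image fun σ : N ≃ₐ[K] N => σ z
  have hS : ∀ s, s ∈ S ↔ ∃ σ : N ≃ₐ[K] N, σ z = s := by simp [S]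
  have hzS : z ∈ S := (hS z).2 ⟨1, rfl⟩
  have h0 : (0 : N) ∉ S := by
    rw [hS]
    rintro ⟨σ, hσ⟩
    exact hz (by simpa using hσ)
  have hmap : ∀ σ : N ≃ₐ[K] N, S.map σ.toEquiv.toEmbedding = S := by
    intro σ
    refine Finset.eq_of_subset_of_card_le (fun s hs => ?_) (by simp)
    obtain ⟨t, ht, rfl⟩ := Finset.mem_map.1 hs
    obtain ⟨τ, rfl⟩ := (hS t).1 ht
    exact (hS _).2 ⟨σ * τ, rfl⟩
  have hK : ∀ n, ∃ c : K, algebraMap K N c = ∑ T ∈ S.powersetCard n, ∏ t ∈ T, t := by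
    intro n
    refine (InfiniteGalois.mem_range_algebraMap_iff_fixed (k := K) _).2 fun σ => ?_
    conv_rhs => rw [← hmap σ, Finset.powersetCard_map, Finset.sum_map]
    rw [map_sum]
    refine Finset.sum_congr rfl fun T _ => ?_
    rw [map_prod]
    exact (Finset.prod_map T σ.toEquiv.toEmbedding fun t => t).symm
  -- With `n = |U|` and `P` the product over `U`, the symmetric functions of degrees `n` and `n + 1`
  -- are dominated by `P` and `z * P`. Their quotient `c₂ / c₁` lies in `K` and approximates `z`.
  let U := S.filter fun s => w z < w s
  have hzU : z ∉ U := by simp [U]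
  have hU : U ⊆ S := Finset.filter_subset _ _
  have h1 := map_esymm_sub_prod_lt w h0 hU fun s hs u hu => by
    simp only [U, Finset.mem_sdiff, Finset.mem_filter, not_and, not_lt] at hs hu
    exact (hs.2 hs.1).trans_lt hu.2
  have h2 := map_esymm_sub_prod_lt w (U := insert z U) h0
    (Finset.insert_subset hzS hU) fun s hs u hu => by
      obtain ⟨hsS, hs⟩ := Finset.mem_sdiff.1 hs
      have hsz : w s < w z := by
        have hsz : s ≠ z := fun h => hs (h ▸ Finset.mem_insert_self _ _)
        refine lt_of_le_of_ne (not_lt.1 fun hlt =>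
          hs (Finset.mem_insert_of_mem (Finset.mem_filter.2 ⟨hsS, hlt⟩))) fun heq => ?_
        obtain ⟨σ, rfl⟩ := (hS s).1 hsS
        exact hsz (h σ heq)
      obtain rfl | hu := Finset.mem_insert.1 hu
      · exact hsz
      · exact hsz.trans (Finset.mem_filter.1 hu).2
  rw [Finset.card_insert_of_notMem hzU, Finset.prod_insert hzU] at h2
  obtain ⟨c₁, hc₁⟩ := hK U.card
  obtain ⟨c₂, hc₂⟩ := hK (U.card + 1)
  rw [← hc₁] at h1
  rw [← hc₂] at h2
  generalize hP : ∏ u ∈ U, u = P at h1 h2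
  have hw1 : w (algebraMap K N c₁) = w P :=
    map_eq_of_map_sub_lt w h1
  have hP0 : w P ≠ 0 := fun h => by rw [h] at h1; exact not_lt_zero h1
  have hc0 : algebraMap K N c₁ ≠ 0 := by rwa [← w.ne_zero_iff, hw1]
  refine ⟨c₂ / c₁, ?_⟩
  rw [← mul_lt_mul_iff_left₀ (zero_lt_iff.2 hP0)]
  conv_lhs => rw [← hw1]
  rw [← map_mul, map_div₀, sub_mul, div_mul_cancel₀ _ hc0, ← map_mul w z P]
  have : z * algebraMap K N c₁ - algebraMap K N c₂ =
    z * (algebraMap K N c₁ - P) - (algebraMap K N c₂ - z * P) := by ring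
  rw [this]
  refine w.map_sub_lt ?_ h2
  rw [map_mul, map_mul]
  exact mul_lt_mul_of_pos_left h1 (by simpa [zero_lt_iff] using hz)

theorem map_prod_sub_one_lt_one {ι : Type*} (w : Valuation N Γ) (s : Finset ι) (f : ι → N)
    (h : ∀ i ∈ s, w (f i - 1) < 1) : w (∏ i ∈ s, f i - 1) < 1 := by
  classical
  induction s using Finset.induction_on with
  | empty => simp
  | insert a s ha ih =>
    rw [Finset.prod_insert ha]
    have h1 := h a (Finset.mem_insert_self _ _)
    have h2 := ih fun i hi => h i (Finset.mem_insert_of_mem hi)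
    have h3 : w (∏ i ∈ s, f i) = 1 := by
      rw [map_eq_of_map_sub_lt w (by rwa [map_one]), map_one]
    have : f a * ∏ i ∈ s, f i - 1 = (f a - 1) * ∏ i ∈ s, f i + (∏ i ∈ s, f i - 1) := by ring
    rw [this]
    exact w.map_add_lt (by rwa [map_mul, h3, mul_one]) h2

/-- In a finite Galois extension there is an element that is congruent to `1` at a given
valuation and non-unit integral at all its other conjugates. -/
theorem exists_map_sub_one_lt_one [FiniteDimensional K N] [IsGalois K N] (w : Valuation N Γ) :
    ∃ b : N, w (b - 1) < 1 ∧ ∀ σ : N ≃ₐ[K] N, (∃ y, w (σ y) ≠ w y) → w (σ b) < 1 := by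
  classical
  let v : Valuation K Γ := w.comap (algebraMap K N)
  have hv : v.HasExtension w := ⟨Valuation.IsEquiv.refl⟩
  have hσ (σ : N ≃ₐ[K] N) : v.HasExtension (w.comap (σ : N →+* N)) := ⟨by
    have : (w.comap (σ : N →+* N)).comap (algebraMap K N) = v := by
      ext x
      change w (σ (algebraMap K N x)) = _
      rw [σ.commutes]
      rfl
    exact this ▸ Valuation.IsEquiv.refl⟩
  let P (σ : N ≃ₐ[K] N) := integralCenter v (w.comap (σ : N →+* N))
  let D : Finset (N ≃ₐ[K] N) := Finset.univ.filter fun σ => ∃ y, w (σ y) ≠ w y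
  -- Otherwise primality and maximality would make some `P σ` equal to the center of `w`, forcing
  -- `σ` to preserve `w`.
  have hnot : ¬ D.inf P ≤ integralCenter v w := by
    rw [(inferInstance : (integralCenter v w).IsPrime).inf_le']
    rintro ⟨σ, hσD, hle⟩
    have heq : P σ = integralCenter v w :=
      Ideal.IsMaximal.eq_of_le inferInstance (Ideal.IsPrime.ne_top inferInstance) hle
    obtain ⟨y, hy⟩ := (Finset.mem_filter.1 hσD).2
    refine hy (map_eq_of_isEquiv_comap w σ
      (isEquiv_comap_of_integralCenter v w w σ fun x hx => ?_) y)
    have : (⟨x, hx⟩ : integralClosure v.integer N) ∈ P σ ↔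
        (⟨x, hx⟩ : integralClosure v.integer N) ∈ integralCenter v w := by rw [heq]
    exact this.symm
  obtain ⟨b, hb, hbn⟩ := Set.not_subset.1 hnot
  -- Multiplying by an inverse modulo the center makes `b` congruent to `1` without leaving the
  -- other centers.
  obtain ⟨c, hc⟩ := Ideal.IsMaximal.exists_inv (inferInstance : (integralCenter v w).IsMaximal) hbn
  obtain ⟨i, hi, hci⟩ := hc
  refine ⟨(c * b : integralClosure v.integer N), ?_, fun σ hσD => ?_⟩
  · rw [← w.map_neg]
    have : -(((c * b : integralClosure v.integer N) : N) - 1) = i := by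
      have := congrArg (algebraMap (integralClosure v.integer N) N) hci
      simp only [map_add, map_one] at this
      rw [← this]
      change -((algebraMap _ N (c * b)) - _) = algebraMap _ N i
      ring
    rw [this]
    exact hi
  · have hmem : b ∈ P σ := (Finset.inf_le (f := P) (Finset.mem_filter.2 ⟨Finset.mem_univ σ, hσD⟩)) hb
    exact (P σ).mul_mem_left c hmem

/-- An element of a finite Galois extension that is fixed by the decomposition group can be
approximated by elements of the base field. -/
theorem exists_map_sub_lt_of_fixed [FiniteDimensional K N] [IsGalois K N] (w : Valuation N Γ)
    {x : N} (hx : x ≠ 0) (h : ∀ σ : N ≃ₐ[K] N, (∀ y, w (σ y) = w y) → σ x = x) :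
    ∃ c : K, w (x - algebraMap K N c) < w x := by
  classical
  obtain ⟨b, hb1, hb⟩ := exists_map_sub_one_lt_one (K := K) w
  let D : Finset (N ≃ₐ[K] N) := Finset.univ.filter fun σ => ∀ y, w (σ y) = w y
  have hD : ∀ σ, σ ∈ D ↔ ∀ y, w (σ y) = w y := by simp [D]
  -- Taking the product over `D` makes `y` invariant under `D` while keeping it congruent to `1` at
  -- `w` and small at the other conjugates.
  let y := ∏ τ ∈ D, τ b
  have hy1 : w (y - 1) < 1 := map_prod_sub_one_lt_one w D _ fun τ hτ => by
    have := (hD τ).1 hτ (b - 1)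
    rw [map_sub, map_one] at this
    rwa [this]
  have hwy : w y = 1 := by
    rw [map_eq_of_map_sub_lt w (by rwa [map_one]), map_one]
  have hyD : ∀ σ ∈ D, σ y = y := by
    intro σ hσ
    simp only [y, map_prod]
    refine Finset.prod_bij' (fun τ _ => σ * τ) (fun τ _ => σ⁻¹ * τ) ?_ ?_ ?_ ?_ ?_
    · intro τ hτ
      rw [hD] at *
      exact fun z => (hσ (τ z)).trans (hτ z)
    · intro τ hτ
      rw [hD] at *
      intro z
      have := hσ (σ⁻¹ (τ z))
      rw [← AlgEquiv.mul_apply, mul_inv_cancel, AlgEquiv.one_apply] at this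
      exact this.symm.trans (hτ z)
    · intro τ _; simp
    · intro τ _; simp
    · intro τ _; rfl
  have hyn : ∀ σ, σ ∉ D → w (σ y) < 1 := by
    intro σ hσ
    simp only [y, map_prod]
    have hne : D.Nonempty := ⟨1, (hD 1).2 fun _ => rfl⟩
    obtain ⟨τ, hτ, hmax⟩ := D.exists_max_image (fun τ => w (σ (τ b))) hne
    refine (Finset.prod_le_pow_card _ _ _ hmax).trans_lt
      (pow_lt_one₀ zero_le (hb (σ * τ) ?_) hne.card_pos.ne')
    by_contra! hστ
    refine hσ ((hD σ).2 fun z => ?_)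
    have h1 := hστ (τ⁻¹ z)
    have h2 := (hD τ).1 hτ (τ⁻¹ z)
    rw [← AlgEquiv.mul_apply, mul_inv_cancel, AlgEquiv.one_apply] at h2
    rw [← AlgEquiv.mul_apply, mul_assoc, mul_inv_cancel, mul_one] at h1
    exact h1.trans h2.symm
  -- For each `σ ∉ D` the left side is strictly decreasing in `k`, so finitely many exponents are
  -- bad. For a good `k`, every conjugate of `x * y ^ k` with its value equals it.
  obtain ⟨k, hk⟩ : ∃ k : ℕ, ∀ σ, σ ∉ D → w (σ x) * w (σ y) ^ k ≠ w x := by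
    have hfin : (⋃ σ ∈ {σ | σ ∉ D}, {k : ℕ | w (σ x) * w (σ y) ^ k = w x}).Finite := by
      refine Set.Finite.biUnion (Set.toFinite _) fun σ hσ => Set.Subsingleton.finite ?_
      intro k hk l hl
      have hsx : w (σ x) ≠ 0 := by simpa using hx
      have hsy : 0 < w (σ y) := by
        rw [zero_lt_iff, w.ne_zero_iff, map_ne_zero, ← w.ne_zero_iff, hwy]
        exact one_ne_zero
      have := mul_left_cancel₀ hsx (Eq.trans hk (Eq.symm hl))
      exact (pow_right_strictAnti₀ hsy (hyn σ hσ)).injective this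
    obtain ⟨k, hk⟩ := hfin.exists_notMem
    refine ⟨k, fun σ hσ heq => hk ?_⟩
    simp only [Set.mem_iUnion]
    exact ⟨σ, hσ, heq⟩
  have hwz : w (x * y ^ k) = w x := by rw [map_mul, map_pow, hwy, one_pow, mul_one]
  obtain ⟨c, hc⟩ := exists_map_sub_lt_of_isolated (K := K) w (z := x * y ^ k)
    (by rwa [← w.ne_zero_iff, hwz, w.ne_zero_iff]) fun σ hσ => by
      by_cases hσD : σ ∈ D
      · rw [map_mul, map_pow, hyD σ hσD, h σ ((hD σ).1 hσD)]
      · rw [hwz, map_mul, map_pow, map_mul, map_pow] at hσ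
        exact absurd hσ (hk σ hσD)
  refine ⟨c, ?_⟩
  rw [hwz] at hc
  have : x - algebraMap K N c = x * y ^ k - algebraMap K N c - x * (y ^ k - 1) := by ring
  rw [this]
  refine w.map_sub_lt hc ?_
  rw [map_mul]
  have hyk := map_prod_sub_one_lt_one w (Finset.range k) (fun _ => y) fun _ _ => hy1
  rw [Finset.prod_const, Finset.card_range] at hyk
  exact mul_lt_of_lt_one_right (by simpa [zero_lt_iff] using hx) hyk

end Approximation

/-! ### Immediacy of the henselization -/

section HenselizationImmediate

variable {K Ω Γ : Type*} [Field K] [Field Ω] [Algebra K Ω] [LinearOrderedCommGroupWithZero Γ]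

/-- The henselization is an immediate extension. -/
theorem exists_map_sub_lt_of_mem_henselization [IsAlgClosure K Ω] (vbar : Valuation Ω Γ) {x : Ω}
    (hx : x ∈ henselization K vbar) (hx0 : x ≠ 0) :
    ∃ c : K, vbar (x - algebraMap K Ω c) < vbar x := by
  have : Normal K Ω := IsAlgClosure.normal K Ω
  have : Algebra.IsAlgebraic K Ω := IsAlgClosure.isAlgebraic
  obtain ⟨hsep, hfix⟩ := (mem_henselization_iff vbar).1 hx
  let E := IntermediateField.adjoin K {x}
  have : FiniteDimensional K E :=
    IntermediateField.adjoin.finiteDimensional (Algebra.IsIntegral.isIntegral x)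
  have : Algebra.IsSeparable K E :=
    IntermediateField.isSeparable_adjoin_simple_iff_isSeparable _ _ |>.2 (mem_separableClosure_iff.1 hsep)
  let N : IntermediateField K Ω := IntermediateField.normalClosure K E Ω
  have hNsep : N ≤ separableClosure K Ω := iSup_le fun f => by
    rintro _ ⟨y, rfl⟩
    exact mem_separableClosure_iff.2 ((Algebra.IsSeparable.isSeparable K y).map f f.injective)
  have : Algebra.IsSeparable K N := (le_separableClosure_iff K Ω N).1 hNsep
  have : IsGalois K N := ⟨⟩
  have : FiniteDimensional K N := normalClosure.is_finiteDimensional K E Ω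
  have hxN : x ∈ N := E.le_normalClosure (IntermediateField.mem_adjoin_simple_self K x)
  let w : Valuation N Γ := vbar.comap (algebraMap N Ω)
  have : IsAlgClosed Ω := IsAlgClosure.isAlgClosed K
  have : IsAlgClosure N Ω := ⟨inferInstance, Algebra.IsAlgebraic.tower_top (K := K) N⟩
  obtain ⟨c, hc⟩ := exists_map_sub_lt_of_fixed (K := K) w (x := ⟨x, hxN⟩)
    (fun h => hx0 (congrArg Subtype.val h)) fun σ hσ => by
      let ρ : Ω ≃ₐ[K] Ω := σ.liftNormal Ω
      have hρ : ∀ y : N, ρ (algebraMap N Ω y) = algebraMap N Ω (σ y) :=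
        AlgEquiv.liftNormal_commutes σ Ω
      have : w.HasExtension vbar := ⟨Valuation.IsEquiv.refl⟩
      have : w.HasExtension (vbar.comap (ρ : Ω →+* Ω)) := ⟨by
        have : (vbar.comap (ρ : Ω →+* Ω)).comap (algebraMap N Ω) = w := by
          ext y
          exact (congrArg vbar (hρ y)).trans (hσ y)
        exact this ▸ Valuation.IsEquiv.refl⟩
      -- The lift `ρ` of `σ` need not preserve `vbar`, but `vbar` and `vbar ∘ ρ` both extend `w`.
      -- Composing with `τ`, which fixes `N`, repairs this without changing the action on `x`.
      obtain ⟨τ, hτ⟩ := exists_algEquiv_isEquiv w vbar (vbar.comap (ρ : Ω →+* Ω))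
      have := hfix ((τ.restrictScalars K).trans ρ) (map_eq_of_isEquiv_comap vbar _ hτ)
      have hτx : τ x = x := τ.commutes ⟨x, hxN⟩
      refine Subtype.ext ((hρ ⟨x, hxN⟩).symm.trans ?_)
      change ρ (τ x) = x at this
      rwa [hτx] at this
  exact ⟨c, hc⟩

end HenselizationImmediate

/-! ### The compositum `L·K^h` and finiteness of `[L^h : K^h]` -/

section Compositum

variable {K L Ω Γ : Type*} [Field K] [Field L] [Field Ω] [Algebra K L] [Algebra L Ω] [Algebra K Ω]
  [IsScalarTower K L Ω] [LinearOrderedCommGroupWithZero Γ]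

/-- An element that is separable over an intermediate field `M` of a normal extension lies in
`M` if it is fixed by all automorphisms over `M`. -/
theorem mem_of_isSeparable_of_fixed [Normal L Ω] (M : IntermediateField L Ω) {x : Ω}
    (hx : IsSeparable L x) (h : ∀ σ : Ω ≃ₐ[M] Ω, σ x = x) : x ∈ M := by
  have : Normal M Ω := Normal.tower_top_of_normal L M Ω
  have hx' : x ∈ separableClosure M Ω := mem_separableClosure_iff.2 (hx.tower_top M)
  obtain ⟨y, hy⟩ := (InfiniteGalois.mem_range_algebraMap_iff_fixed (k := M)
    (⟨x, hx'⟩ : separableClosure M Ω)).2 fun σ => Subtype.ext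
      ((AlgEquiv.liftNormal_commutes σ Ω ⟨x, hx'⟩).symm.trans (h (σ.liftNormal Ω)))
  have hxy : (y : Ω) = x := congrArg Subtype.val hy
  exact hxy ▸ y.2

/-- `L^h` is contained in the compositum of `L` and `K^h`. -/
theorem henselization_le_adjoin [Normal K Ω] (wbar : Valuation Ω Γ) :
    henselization L wbar ≤ IntermediateField.adjoin L (henselization K wbar : Set Ω) := by
  have : Normal L Ω := Normal.tower_top_of_normal K L Ω
  intro x hx
  obtain ⟨hsep, hfix⟩ := (mem_henselization_iff wbar).1 hx
  -- An automorphism fixing `L` and `K^h` preserves `wbar`, so it fixes `L^h`.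
  refine mem_of_isSeparable_of_fixed _ (mem_separableClosure_iff.1 hsep) fun σ => ?_
  refine hfix (σ.restrictScalars L) fun y => ?_
  exact map_eq_of_fixes_henselization wbar ((σ.restrictScalars L).restrictScalars K) (fun z hz =>
    σ.commutes ⟨z, IntermediateField.subset_adjoin L _ hz⟩) y

/-- The degree `[L^h : K^h]` is finite if `[L : K]` is. -/
theorem relfinrank_henselization_ne_zero [Normal K Ω] [FiniteDimensional K L]
    (wbar : Valuation Ω Γ) :
    IntermediateField.relfinrank (henselization K wbar)
      ((henselization L wbar).restrictScalars K) ≠ 0 := by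
  rw [IntermediateField.relfinrank_eq_finrank_of_le (henselization_le K L wbar)]
  let b := Module.finBasis K L
  let M : IntermediateField (henselization K wbar) Ω :=
    IntermediateField.adjoin _ (Set.range fun i => algebraMap L Ω (b i))
  have hKM : ∀ c : K, algebraMap K Ω c ∈ M := fun c =>
    M.algebraMap_mem (algebraMap K (henselization K wbar) c)
  have hM : FiniteDimensional (henselization K wbar) M := by
    refine IntermediateField.finiteDimensional_adjoin fun x _ => ?_
    exact (Normal.isIntegral ‹Normal K Ω› x).tower_top
  have hLM : ∀ l : L, algebraMap L Ω l ∈ M.toSubfield := by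
    intro l
    rw [← b.sum_repr l, map_sum]
    refine sum_mem fun i _ => ?_
    rw [Algebra.smul_def, map_mul, ← IsScalarTower.algebraMap_apply]
    exact mul_mem (hKM _) (IntermediateField.subset_adjoin _ _ ⟨i, rfl⟩)
  have hle : IntermediateField.extendScalars (henselization_le K L wbar) ≤ M := by
    intro x hx
    have h1 : henselization L wbar ≤ Subfield.toIntermediateField M.toSubfield hLM :=
      (henselization_le_adjoin (K := K) wbar).trans (IntermediateField.adjoin_le_iff.2
        fun z hz => M.algebraMap_mem ⟨z, hz⟩)
    exact h1 hx
  have : FiniteDimensional (henselization K wbar)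
      (IntermediateField.extendScalars (henselization_le K L wbar)) :=
    Module.Finite.of_injective (IntermediateField.inclusion hle).toLinearMap
      (IntermediateField.inclusion hle).injective
  exact Module.finrank_pos.ne'

end Compositum

/-! ### Immediacy as approximability -/

section Immediate

variable {K L Γ₀ Γ₁ : Type*} [Field K] [Field L] [Algebra K L]
  [LinearOrderedCommGroupWithZero Γ₀] [LinearOrderedCommGroupWithZero Γ₁]

theorem mem_valueGroup_iff (w : Valuation L Γ₁) {γ : Γ₁ˣ} :
    γ ∈ valueGroup w ↔ ∃ x : L, w x = γ := by
  constructor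
  · intro h
    have : (γ : Γ₁) ∈ Units.val '' (valueGroup w : Set Γ₁ˣ) := ⟨γ, h, rfl⟩
    erw [MonoidWithZeroHom.valueGroup_eq_range] at this
    exact this.1
  · rintro ⟨x, hx⟩
    exact MonoidWithZeroHom.mem_valueGroup _ ⟨x, hx⟩

/-- An extension `(L | K, w | v)` is immediate if and only if for every nonzero `x ∈ L` there is
`c ∈ K` with `w (x - c) < w x`. -/
theorem isImmediate_iff (v : Valuation K Γ₀) (w : Valuation L Γ₁) [v.HasExtension w] :
    IsImmediate v w ↔ ∀ x : L, x ≠ 0 → ∃ c : K, w (x - algebraMap K L c) < w x := by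
  have hres : ∀ y : w.valuationSubring, residue _ y = 0 ↔ w (y : L) < 1 := fun y => by
    rw [residue_eq_zero_iff, Valuation.mem_maximalIdeal_iff]
  constructor
  · rintro ⟨hval, -, hsurj⟩ x hx
    have hγ : Units.mk0 (w x) ((w.ne_zero_iff).2 hx) ∈ valueGroup w :=
      (mem_valueGroup_iff w).2 ⟨x, rfl⟩
    rw [hval] at hγ
    obtain ⟨c, hc⟩ := (mem_valueGroup_iff _).1 hγ
    change w (algebraMap K L c) = w x at hc
    have hc0 : algebraMap K L c ≠ 0 := by rwa [← w.ne_zero_iff, hc, w.ne_zero_iff]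
    have hy : w (x / algebraMap K L c) = 1 := by
      rw [map_div₀, hc, div_self ((w.ne_zero_iff).2 hx)]
    obtain ⟨r, hr⟩ := hsurj (residue _ (⟨x / algebraMap K L c, hy.le⟩ : w.valuationSubring))
    obtain ⟨a, rfl⟩ := residue_surjective r
    rw [Valuation.HasExtension.algebraMap_residue_eq_residue_algebraMap, eq_comm, ← sub_eq_zero,
      ← map_sub, hres] at hr
    change w (x / algebraMap K L c - algebraMap K L a) < 1 at hr
    -- `c` matches the value of `x`, and `a` the residue of `x / c`.
    refine ⟨c * a, ?_⟩
    have : x - algebraMap K L (c * a) =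
        (x / algebraMap K L c - algebraMap K L a) * algebraMap K L c := by
      rw [map_mul]; field_simp
    rw [this, map_mul, hc]
    exact mul_lt_of_lt_one_left (by simpa [zero_lt_iff] using hx) hr
  · intro h
    refine ⟨le_antisymm (fun γ hγ => ?_) fun γ hγ => ?_, RingHom.injective _, fun r => ?_⟩
    · obtain ⟨x, hx⟩ := (mem_valueGroup_iff w).1 hγ
      obtain ⟨c, hc⟩ := h x (by rintro rfl; exact γ.ne_zero (by simpa using hx.symm))
      refine (mem_valueGroup_iff _).2 ⟨c, ?_⟩
      rw [← hx]
      rw [w.map_sub_swap] at hc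
      exact map_eq_of_map_sub_lt w hc
    · obtain ⟨c, hc⟩ := (mem_valueGroup_iff _).1 hγ
      exact (mem_valueGroup_iff w).2 ⟨_, hc⟩
    · obtain ⟨y, rfl⟩ := residue_surjective r
      by_cases hy : w (y : L) < 1
      · exact ⟨0, by rw [map_zero, (hres y).2 hy]⟩
      have hy1 : w (y : L) = 1 := le_antisymm y.2 (not_lt.1 hy)
      obtain ⟨c, hc⟩ := h y (by rintro h; simp [h] at hy1)
      have hc1 : w (algebraMap K L c) = 1 := by
        rw [w.map_sub_swap] at hc
        rw [map_eq_of_map_sub_lt w hc, hy1]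
      have hcv : v c ≤ 1 := (Valuation.HasExtension.val_map_le_one_iff v w c).1 hc1.le
      refine ⟨residue _ ⟨c, hcv⟩, ?_⟩
      rw [Valuation.HasExtension.algebraMap_residue_eq_residue_algebraMap, eq_comm, ← sub_eq_zero,
        ← map_sub, hres]
      rw [hy1] at hc
      exact hc

/-- The defect of an immediate extension is the degree of the henselizations. -/
theorem defect_eq_of_isImmediate {Ω Γ₂ : Type*} [Field Ω] [Algebra L Ω] [Algebra K Ω]
    [IsScalarTower K L Ω] [LinearOrderedCommGroupWithZero Γ₂]
    (v : Valuation K Γ₀) (w : Valuation L Γ₁) [v.HasExtension w] (wbar : Valuation Ω Γ₂)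
    (h : IsImmediate v w) :
    defect v w wbar = (IntermediateField.relfinrank (henselization K wbar)
      ((henselization L wbar).restrictScalars K) : ℚ) := by
  have he : ramificationIndex K w = 1 := by
    rw [ramificationIndex, h.1, Subgroup.relIndex_self]
  have hf : inertiaDegree v w = 1 := by
    have e : ResidueField v.valuationSubring ≃ₗ[ResidueField v.valuationSubring]
        ResidueField w.valuationSubring :=
      LinearEquiv.ofBijective (Algebra.linearMap _ _) h.2
    rw [inertiaDegree, ← e.finrank_eq, Module.finrank_self]
  rw [defect, he, hf]
  simp

end Immediate

/-! ### The two implications -/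

section Main

theorem hasExtension_trans {K L Ω Γ₀ Γ₁ Γ₂ : Type*} [Field K] [Field L] [Field Ω] [Algebra K L]
    [Algebra L Ω] [Algebra K Ω] [IsScalarTower K L Ω] [LinearOrderedCommGroupWithZero Γ₀]
    [LinearOrderedCommGroupWithZero Γ₁] [LinearOrderedCommGroupWithZero Γ₂]
    (v : Valuation K Γ₀) (w : Valuation L Γ₁) (wbar : Valuation Ω Γ₂)
    [v.HasExtension w] [w.HasExtension wbar] : v.HasExtension wbar := by
  refine ⟨Valuation.isEquiv_of_val_le_one fun x => ?_⟩
  rw [Valuation.comap_apply, IsScalarTower.algebraMap_apply K L Ω,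
    Valuation.HasExtension.val_map_le_one_iff w wbar,
    Valuation.HasExtension.val_map_le_one_iff v w]

theorem isTorsionFree_of_field (K Ω : Type*) [Field K] [Field Ω] [Algebra K Ω] :
    Module.IsTorsionFree K Ω := inferInstance

theorem isAlgClosure_of_isAlgebraic (K L Ω : Type*) [Field K] [Field L] [Field Ω] [Algebra K L]
    [Algebra L Ω] [Algebra K Ω] [IsScalarTower K L Ω] [Algebra.IsAlgebraic K L]
    [IsAlgClosure L Ω] : IsAlgClosure K Ω :=
  have : Algebra.IsAlgebraic L Ω := IsAlgClosure.isAlgebraic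
  ⟨IsAlgClosure.isAlgClosed L, Algebra.IsAlgebraic.trans K L Ω⟩

theorem isAlgClosure_intermediateField {K Ω : Type*} [Field K] [Field Ω] [Algebra K Ω]
    [IsAlgClosure K Ω] (E : IntermediateField K Ω) : IsAlgClosure E Ω :=
  have : Algebra.IsAlgebraic K Ω := IsAlgClosure.isAlgebraic
  ⟨IsAlgClosure.isAlgClosed K, Algebra.IsAlgebraic.tower_top (K := K) E⟩

variable {K : Type u} [Field K] {Γ₀ : Type*} [LinearOrderedCommGroupWithZero Γ₀]
    (v : Valuation K Γ₀) {Kbar : Type u} [Field Kbar] [Algebra K Kbar] [IsAlgClosure K Kbar]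
    {Γ : Type*} [LinearOrderedCommGroupWithZero Γ] (vbar : Valuation Kbar Γ)
    [v.HasExtension vbar]

theorem isImmediateDefectless_of_isAlgebraicallyMaximal
    (hmax : IsAlgebraicallyMaximal (henselizationValuation K vbar)) :
    IsImmediateDefectless v := by
  rintro L _ _ Γ₁ _ w _ ⟨himm, hfin, Γ₂, _, wbar, _, hdef⟩
  rw [defect_eq_of_isImmediate v w wbar himm] at hdef
  have : v.HasExtension wbar := hasExtension_trans v w wbar
  have : IsAlgClosure K (AlgebraicClosure L) := isAlgClosure_of_isAlgebraic K L _
  have : Normal K Kbar := IsAlgClosure.normal K Kbar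
  have : Algebra.IsAlgebraic K (AlgebraicClosure L) := IsAlgClosure.isAlgebraic
  -- The defect uses the henselization of `K` in `AlgebraicClosure L`; `φ` identifies it with the
  -- one in `Kbar` and makes `L^h` an extension of the latter.
  obtain ⟨φ, hφ⟩ := exists_algEquiv_isEquiv v vbar wbar
  let E := (henselization L wbar).restrictScalars K
  let f : henselization K vbar →+* E :=
    ((φ : Kbar →+* AlgebraicClosure L).comp (algebraMap (henselization K vbar) Kbar)).codRestrict
      E fun x => henselization_le K L wbar ((map_mem_henselization_iff vbar wbar φ hφ).2 x.2)
  let _ : Algebra (henselization K vbar) E := f.toAlgebra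
  have hf : ∀ x : henselization K vbar,
      (algebraMap (henselization K vbar) E x : AlgebraicClosure L) = φ x := fun _ => rfl
  have : IsScalarTower K (henselization K vbar) E := IsScalarTower.of_algebraMap_eq fun x =>
    Subtype.ext (φ.commutes x).symm
  let wE : Valuation E Γ₂ := wbar.comap (algebraMap E (AlgebraicClosure L))
  have hE : (henselizationValuation K vbar).HasExtension wE := ⟨fun x y => hφ x y⟩
  have himmE : IsImmediate (henselizationValuation K vbar) wE := by
    rw [isImmediate_iff]
    intro x hx
    have hx0 : (x : AlgebraicClosure L) ≠ 0 := fun h => hx (Subtype.ext h)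
    -- Approximate `x ∈ L^h` by `l ∈ L`, then `l` by an element of `K`.
    obtain ⟨l, hl⟩ := exists_map_sub_lt_of_mem_henselization (K := L) wbar x.2 hx0
    have hlx : wbar (algebraMap L _ l) = wbar x := by
      rw [wbar.map_sub_swap] at hl
      exact map_eq_of_map_sub_lt wbar hl
    have hl0 : l ≠ 0 := by
      rintro rfl
      rw [map_zero, map_zero, eq_comm, map_eq_zero] at hlx
      exact hx0 hlx
    obtain ⟨c, hc⟩ := (isImmediate_iff v w).1 himm l hl0
    rw [← Valuation.HasExtension.val_map_lt_iff w wbar, hlx, map_sub,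
      ← IsScalarTower.algebraMap_apply] at hc
    refine ⟨algebraMap K _ c, ?_⟩
    rw [← IsScalarTower.algebraMap_apply]
    change wbar ((x : AlgebraicClosure L) - algebraMap K (AlgebraicClosure L) c) < wbar x
    rw [← sub_add_sub_cancel _ (algebraMap L (AlgebraicClosure L) l)]
    exact wbar.map_add_lt hl hc
  have hsurj := (hmax E Γ₂ wE (Algebra.IsAlgebraic.tower_top (K := K) _) himmE).2
  have hle : E ≤ henselization K wbar := by
    intro y hy
    obtain ⟨x, hx⟩ := hsurj ⟨y, hy⟩
    have : φ x = y := congrArg Subtype.val hx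
    rw [← this]
    exact (map_mem_henselization_iff vbar wbar φ hφ).2 x.2
  rw [IntermediateField.relfinrank_eq_one_iff.2 hle] at hdef
  norm_num at hdef

theorem isAlgebraicallyMaximal_of_isImmediateDefectless (hdl : IsImmediateDefectless v) :
    IsAlgebraicallyMaximal (henselizationValuation K vbar) := by
  intro F _ _ Γ₁ _ w _ halg himm
  refine ⟨(algebraMap (henselization K vbar) F).injective, ?_⟩
  by_contra hsurj
  simp only [Function.Surjective, not_forall] at hsurj
  obtain ⟨a, ha⟩ := hsurj
  have : Normal K Kbar := IsAlgClosure.normal K Kbar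
  have : Algebra.IsAlgebraic K Kbar := IsAlgClosure.isAlgebraic
  let H := henselization K vbar
  let vh : Valuation H Γ := henselizationValuation K vbar
  let _ : Algebra K F := ((algebraMap H F).comp (algebraMap K H)).toAlgebra
  have : IsScalarTower K H F := IsScalarTower.of_algebraMap_eq' rfl
  have : Algebra.IsAlgebraic K F := Algebra.IsAlgebraic.trans K H F
  have : v.HasExtension vh := ⟨Valuation.HasExtension.val_isEquiv_comap (vA := vbar)⟩
  have : vh.HasExtension w := ‹_›
  have : v.HasExtension w := hasExtension_trans v vh w
  let L := IntermediateField.adjoin K {a}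
  have : FiniteDimensional K L :=
    IntermediateField.adjoin.finiteDimensional (Algebra.IsIntegral.isIntegral a)
  let wL : Valuation L Γ₁ := w.comap (algebraMap L F)
  have : v.HasExtension wL := ⟨Valuation.HasExtension.val_isEquiv_comap (vA := w)⟩
  have : wL.HasExtension w := ⟨Valuation.IsEquiv.refl⟩
  have himmL : IsImmediate v wL := by
    rw [isImmediate_iff]
    intro x hx
    have hx0 : (x : F) ≠ 0 := fun h => hx (Subtype.ext h)
    obtain ⟨c, hc⟩ := (isImmediate_iff vh w).1 himm x hx0
    have hcx : w (algebraMap H F c) = w x := by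
      rw [w.map_sub_swap] at hc
      exact map_eq_of_map_sub_lt w hc
    have hc0 : (c : Kbar) ≠ 0 := by
      intro h
      have : c = 0 := Subtype.ext h
      rw [this, map_zero, map_zero, eq_comm, map_eq_zero] at hcx
      exact hx0 hcx
    -- The element `c ∈ K^h` approximating `x` is approximated in turn from `K`.
    obtain ⟨d, hd⟩ := exists_map_sub_lt_of_mem_henselization vbar c.2 hc0
    have hd' : vh (c - algebraMap K H d) < vh c := hd
    rw [← Valuation.HasExtension.val_map_lt_iff vh w, hcx, map_sub,
      ← IsScalarTower.algebraMap_apply] at hd'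
    refine ⟨d, ?_⟩
    change w ((x : F) - algebraMap K F d) < w x
    rw [← sub_add_sub_cancel _ (algebraMap H F c)]
    exact w.map_add_lt hc hd'
  obtain ⟨Γ₂, _, wt, hwt⟩ := exists_valuation_hasExtension (E := AlgebraicClosure F) w
  have : Algebra.IsAlgebraic L F := Algebra.IsAlgebraic.tower_top (K := K) L
  have : Module.IsTorsionFree L (AlgebraicClosure F) := isTorsionFree_of_field _ _
  have : IsAlgClosure L (AlgebraicClosure F) := isAlgClosure_of_isAlgebraic L F _
  have : IsAlgClosure H (AlgebraicClosure F) := isAlgClosure_of_isAlgebraic H F _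
  have : IsAlgClosure H Kbar := isAlgClosure_intermediateField H
  have : IsAlgClosure K (AlgebraicClosure L) := isAlgClosure_of_isAlgebraic K L _
  have : Normal K (AlgebraicClosure L) := IsAlgClosure.normal K _
  have : vh.HasExtension vbar := ⟨Valuation.IsEquiv.refl⟩
  have : vh.HasExtension wt := hasExtension_trans vh w wt
  have : wL.HasExtension wt := hasExtension_trans wL w wt
  obtain ⟨φ, hφ⟩ := exists_algEquiv_isEquiv vh vbar wt
  let ψ : AlgebraicClosure L ≃ₐ[L] AlgebraicClosure F := IsAlgClosure.equiv L _ _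
  let wbar : Valuation (AlgebraicClosure L) Γ₂ := wt.comap (ψ : AlgebraicClosure L →+* _)
  have hwbar : wL.HasExtension wbar := by
    refine ⟨?_⟩
    have : wbar.comap (algebraMap L (AlgebraicClosure L)) =
        wt.comap (algebraMap L (AlgebraicClosure F)) := by
      ext x
      exact congrArg wt (ψ.commutes x)
    rw [this]
    exact Valuation.HasExtension.val_isEquiv_comap
  refine hdl L Γ₁ wL ⟨himmL, inferInstance, Γ₂, inferInstance, wbar, hwbar, ?_⟩
  rw [defect_eq_of_isImmediate v wL wbar himmL]
  -- `relfinrank` is `0` in infinite degree, so `> 1` needs both `≠ 0` and `≠ 1`.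
  have hne0 := relfinrank_henselization_ne_zero (K := K) (L := L) wbar
  have hne1 : IntermediateField.relfinrank (henselization K wbar)
      ((henselization L wbar).restrictScalars K) ≠ 1 := by
    rw [Ne, IntermediateField.relfinrank_eq_one_iff]
    intro hle
    let aL : L := ⟨a, IntermediateField.mem_adjoin_simple_self K a⟩
    have haK : algebraMap L (AlgebraicClosure L) aL ∈ henselization K wbar :=
      hle ((henselization L wbar).algebraMap_mem aL)
    -- `θ` matches the two copies of `K^h`. As `φ` is linear over `K^h`, membership of `a` in the
    -- copy inside `AlgebraicClosure L` would put `a` in the image of `K^h` in `F`.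
    let θ : Kbar ≃ₐ[K] AlgebraicClosure L :=
      (φ.restrictScalars K).trans (ψ.restrictScalars K).symm
    have hψθ : ∀ x, ψ (θ x) = φ x := fun x => ψ.apply_symm_apply (φ x)
    have hθ : vbar.IsEquiv (wbar.comap (θ : Kbar →+* AlgebraicClosure L)) := by
      have : wbar.comap (θ : Kbar →+* AlgebraicClosure L) =
          wt.comap (φ : Kbar →+* AlgebraicClosure F) := by
        ext x
        exact congrArg wt (hψθ x)
      rwa [this]
    obtain ⟨x, hx⟩ := θ.surjective (algebraMap L (AlgebraicClosure L) aL)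
    rw [← hx, map_mem_henselization_iff vbar wbar θ hθ] at haK
    have h1 : φ x = algebraMap F (AlgebraicClosure F) a := by
      rw [← hψθ, hx, ψ.commutes]
      rfl
    have h2 : φ x = algebraMap F (AlgebraicClosure F) (algebraMap H F ⟨x, haK⟩) := by
      rw [← IsScalarTower.algebraMap_apply]
      exact φ.commutes ⟨x, haK⟩
    exact ha ⟨⟨x, haK⟩, (algebraMap F (AlgebraicClosure F)).injective (h2.symm.trans h1)⟩
  have : 1 < IntermediateField.relfinrank (henselization K wbar)
      ((henselization L wbar).restrictScalars K) := by omega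
  exact_mod_cast this

end Main

end ValuedFieldExt

end

theorem mainTheorem3 {K : Type u} [Field K] {Γ₀ : Type*} [LinearOrderedCommGroupWithZero Γ₀]
    (v : Valuation K Γ₀) {Kbar : Type u} [Field Kbar] [Algebra K Kbar] [IsAlgClosure K Kbar]
    {Γ : Type*} [LinearOrderedCommGroupWithZero Γ] (vbar : Valuation Kbar Γ)
    [v.HasExtension vbar] :
    ValuedFieldExt.IsImmediateDefectless v ↔
      ValuedFieldExt.IsAlgebraicallyMaximal (ValuedFieldExt.henselizationValuation K vbar) :=
  ⟨ValuedFieldExt.isAlgebraicallyMaximal_of_isImmediateDefectless v vbar,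
    ValuedFieldExt.isImmediateDefectless_of_isAlgebraicallyMaximal v vbar⟩
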